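/- For a complex number $q$ with $0<|q|<1$ write $(a;q)_\infty=\prod_{j\ge 0}(1-aq^j)$, $(a;q)_k=(a;q)_\infty/(aq^k;q)_\infty$ for $k\in\mathbb Z$, $(a)_k=(a;q)_k$ for $k\in\mathbb Z\cup\{\infty\}$, $(a,b,c;q)_\infty=(a;q)_\infty(b;q)_\infty(c;q)_\infty$, and let $$\left[{N\atop j}\right]_{q}=\frac{(q;q)_N}{(q;q)_j(q;q)_{N-j}}\quad(0\le j\le N),\qquad \left[{N\atop j}\right]_q=0\quad (j<0\text{ or }j>N).$$ **Theorem.** Let $m\ge 0$, $r\ge 2$ and $0\le i\le r-1$ be integers, and let $q\in\mathbb C$ with $0<|q|<1$. Then $$\sum_{s_1\ge\dots\ge s_r\ge-\lfloor m/2\rfloor}\frac{q^{s_1^2+\dots+s_r^2+m(s_1+\dots+s_{r-1})-s_1-\dots-s_i+s_{r-1}-2s_r}\,(-q)_{m+2s_r}}{(q)_{s_1-s_2}\cdots(q)_{s_{r-2}-s_{r-1}}\,(q^2;q^2)_{s_{r-1}-s_r}}\,(-1)^{s_r}\left[{m+s_r\atop m+2s_r}\right]_{q^2}$$ $$=\sum_{k=0}^{i}q^{mk}\,\frac{\bigl(q^{2r},\,q^{(m+1)(r-1)-i+2k},\,q^{(1-m)r+m+i-2k+1};\,q^{2r}\bigr)_\infty}{(q)_\infty},$$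 where the sum runs over integers $s_1,\dots,s_r$ and converges absolutely (for $r=2$ the product $(q)_{s_1-s_2}\cdots(q)_{s_{r-2}-s_{r-1}}$ is empty). -/

import Mathlib

open Finset

namespace QSeries

noncomputable section

/-- The infinite `q`-shifted factorial `(a; q)_∞ = ∏_{j ≥ 0} (1 - a q^j)`. -/
def pochInf (a q : ℂ) : ℂ := ∏' j : ℕ, (1 - a * q ^ j)

/-- The `q`-shifted factorial `(a; q)_k = (a; q)_∞ / (a q^k; q)_∞` with integer index `k`. -/
def poch (a q : ℂ) (k : ℤ) : ℂ := pochInf a q / pochInf (a * q ^ k) q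

/-- `(a, b, c; q)_∞ = (a; q)_∞ (b; q)_∞ (c; q)_∞`. -/
def pochInf₃ (a b c q : ℂ) : ℂ := pochInf a q * pochInf b q * pochInf c q

/-- The `q`-binomial coefficient `[N, j]_q`, extended by `0` to `j < 0` and `j > N`. -/
def qBinom (N j : ℤ) (q : ℂ) : ℂ :=
  if 0 ≤ j ∧ j ≤ N then poch q q N / (poch q q j * poch q q (N - j)) else 0

/-- The coordinate `s_j` (`1 ≤ j ≤ r`) of an `r`-tuple `s = (s_1, …, s_r)` of integers, in one-based
numbering. (The value `0` for other `j` is never used.) -/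
def coord {r : ℕ} (s : Fin r → ℤ) (j : ℕ) : ℤ :=
  if h : 1 ≤ j ∧ j ≤ r then s ⟨j - 1, by omega⟩ else 0

/-- The set of integer tuples `(s_1, …, s_r)` with `s_1 ≥ s_2 ≥ ⋯ ≥ s_r ≥ -⌊m/2⌋`. -/
def chains (m r : ℕ) : Set (Fin r → ℤ) :=
  {s | (∀ j, 1 ≤ j → j < r → coord s (j + 1) ≤ coord s j) ∧ -((m / 2 : ℕ) : ℤ) ≤ coord s r}

/-- The exponent
`s_1² + ⋯ + s_r² + m (s_1 + ⋯ + s_{r-1}) - s_1 - ⋯ - s_i + s_{r-1} - 2 s_r` (for `r ≥ 2`). -/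
def expo (m r i : ℕ) (s : Fin r → ℤ) : ℤ :=
  ∑ j ∈ Icc 1 r, coord s j ^ 2 + (m : ℤ) * ∑ j ∈ Icc 1 (r - 1), coord s j
    - ∑ j ∈ Icc 1 i, coord s j + coord s (r - 1) - 2 * coord s r

/-- The summand of the multisum (for `r ≥ 2`); the first factors of the denominator are
`(q; q)_{s_1 - s_2} ⋯ (q; q)_{s_{r-2} - s_{r-1}}`, an empty product if `r = 2`. -/
def summand (m r i : ℕ) (q : ℂ) (s : Fin r → ℤ) : ℂ :=
  q ^ expo m r i s * poch (-q) q (m + 2 * coord s r) /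
      ((∏ j ∈ Icc 1 (r - 2), poch q q (coord s j - coord s (j + 1))) *
        poch (q ^ 2) (q ^ 2) (coord s (r - 1) - coord s r)) *
    (-1) ^ coord s r * qBinom (m + coord s r) (m + 2 * coord s r) (q ^ 2)

end

end QSeries

namespace QSeries

/-- The reciprocal `1 / (q; q)_k`, which vanishes for negative `k`. -/
noncomputable def invPoch (q : ℂ) (k : ℤ) : ℂ := (poch q q k)⁻¹

lemma zpow_ne_one {q : ℂ} (hq1 : ‖q‖ < 1) {k : ℤ} (hk : k ≠ 0) : q ^ k ≠ 1 := by
  intro h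
  have h1 : ‖q‖ ^ k = 1 := by rw [← norm_zpow, h, norm_one]
  exact hk ((zpow_eq_one_iff_right₀ (norm_nonneg q) hq1.ne).1 h1)

lemma one_add_zpow_ne_zero {q : ℂ} (hq1 : ‖q‖ < 1) (k : ℤ) : 1 + q ^ k ≠ 0 := by
  intro h
  rcases eq_or_ne k 0 with rfl | hk
  · norm_num at h
  have h2 : q ^ k = -1 := by linear_combination h
  have h1 : ‖q‖ ^ k = 1 := by rw [← norm_zpow, h2, norm_neg, norm_one]
  exact hk ((zpow_eq_one_iff_right₀ (norm_nonneg q) hq1.ne).1 h1)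

lemma multipliable_poch (a : ℂ) {q : ℂ} (hq1 : ‖q‖ < 1) :
    Multipliable fun j : ℕ => 1 - a * q ^ j := by
  have h : Summable fun j : ℕ => ‖-(a * q ^ j)‖ := by
    simp only [norm_neg, norm_mul, norm_pow]
    exact (summable_geometric_of_lt_one (norm_nonneg q) hq1).mul_left _
  simpa [sub_eq_add_neg] using multipliable_one_add_of_summable h

lemma pochInf_succ (a : ℂ) {q : ℂ} (hq1 : ‖q‖ < 1) :
    pochInf a q = (1 - a) * pochInf (a * q) q := by
  unfold pochInf
  rw [tprod_eq_zero_mul']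
  · simp [pow_succ', mul_assoc]
  · simpa [pow_succ', mul_assoc] using multipliable_poch (a * q) hq1

lemma pochInf_ne_zero {a q : ℂ} (hq1 : ‖q‖ < 1) (h : ∀ j : ℕ, a * q ^ j ≠ 1) :
    pochInf a q ≠ 0 := by
  have hs : Summable fun j : ℕ => ‖-(a * q ^ j)‖ := by
    simp only [norm_neg, norm_mul, norm_pow]
    exact (summable_geometric_of_lt_one (norm_nonneg q) hq1).mul_left _
  have := tprod_one_add_ne_zero_of_summable (f := fun j : ℕ => -(a * q ^ j))
    (fun j h' => h j (by linear_combination -h')) hs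
  simpa [pochInf, sub_eq_add_neg] using this

lemma pochInf_zpow_ne_zero {q : ℂ} (hq0 : q ≠ 0) (hq1 : ‖q‖ < 1) {k : ℤ} (hk : 0 < k) :
    pochInf (q ^ k) q ≠ 0 := by
  refine pochInf_ne_zero hq1 fun j => ?_
  rw [← zpow_natCast, ← zpow_add₀ hq0]
  exact zpow_ne_one hq1 (by omega)

lemma pochInf_self_ne_zero {q : ℂ} (hq0 : q ≠ 0) (hq1 : ‖q‖ < 1) : pochInf q q ≠ 0 := by
  simpa using pochInf_zpow_ne_zero hq0 hq1 one_pos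

lemma invPoch_eq {q : ℂ} (k : ℤ) : invPoch q k = pochInf (q * q ^ k) q / pochInf q q := by
  simp [invPoch, poch]

lemma invPoch_zero {q : ℂ} (hq0 : q ≠ 0) (hq1 : ‖q‖ < 1) : invPoch q 0 = 1 := by
  simp [invPoch_eq, div_self (pochInf_self_ne_zero hq0 hq1)]

lemma one_sub_mul_invPoch {q : ℂ} (hq0 : q ≠ 0) (hq1 : ‖q‖ < 1) (k : ℤ) :
    (1 - q ^ k) * invPoch q k = invPoch q (k - 1) := by
  rw [invPoch_eq, invPoch_eq, show q * q ^ (k - 1) = q ^ k by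
    rw [zpow_sub_one₀ hq0]; field_simp, pochInf_succ (q ^ k) hq1, mul_comm q]
  ring

lemma invPoch_of_neg {q : ℂ} (hq0 : q ≠ 0) (hq1 : ‖q‖ < 1) {k : ℤ} (hk : k < 0) :
    invPoch q k = 0 := by
  have key : ∀ n : ℕ, invPoch q (-1 - n) = 0 := by
    intro n
    induction n with
    | zero => simpa using (one_sub_mul_invPoch hq0 hq1 0).symm
    | succ n ih =>
      rw [show (-1 - ((n + 1 : ℕ) : ℤ)) = (-1 - n) - 1 by push_cast; ring,
        ← one_sub_mul_invPoch hq0 hq1, ih, mul_zero]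
  have := key (-1 - k).toNat
  rwa [show (-1 - ((-1 - k).toNat : ℤ)) = k by omega] at this

lemma invPoch_ne_zero {q : ℂ} (hq0 : q ≠ 0) (hq1 : ‖q‖ < 1) {k : ℤ} (hk : 0 ≤ k) :
    invPoch q k ≠ 0 := by
  rw [invPoch_eq, ← zpow_one_add₀ hq0]
  exact div_ne_zero (pochInf_zpow_ne_zero hq0 hq1 (by omega)) (pochInf_self_ne_zero hq0 hq1)

lemma inv_invPoch_natCast {q : ℂ} (hq0 : q ≠ 0) (hq1 : ‖q‖ < 1) (n : ℕ) :
    (invPoch q n)⁻¹ = ∏ j ∈ range n, (1 - q * q ^ j) := by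
  induction n with
  | zero => simp [invPoch_zero hq0 hq1]
  | succ n ih =>
    rw [prod_range_succ, ← ih]
    have h := one_sub_mul_invPoch hq0 hq1 ((n + 1 : ℕ) : ℤ)
    have hne : 1 - q * q ^ n ≠ 0 := by
      have := zpow_ne_one hq1 (k := ((n + 1 : ℕ) : ℤ)) (by omega)
      rw [zpow_natCast, pow_succ'] at this
      exact sub_ne_zero.2 this.symm
    rw [zpow_natCast, pow_succ', show (((n + 1 : ℕ) : ℤ) - 1) = n by push_cast; ring] at h
    rw [← h, mul_inv, mul_comm (1 - q * q ^ n)⁻¹, mul_assoc, inv_mul_cancel₀ hne, mul_one]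

lemma tendsto_invPoch_natCast {q : ℂ} (hq0 : q ≠ 0) (hq1 : ‖q‖ < 1) :
    Filter.Tendsto (fun n : ℕ => invPoch q n) Filter.atTop (nhds (pochInf q q)⁻¹) := by
  have h := (multipliable_poch q hq1).hasProd.tendsto_prod_nat.inv₀ (pochInf_self_ne_zero hq0 hq1)
  refine h.congr fun n => ?_
  rw [← inv_invPoch_natCast hq0 hq1, inv_inv]

lemma tendsto_invPoch {q : ℂ} (hq0 : q ≠ 0) (hq1 : ‖q‖ < 1) :
    Filter.Tendsto (invPoch q) Filter.atTop (nhds (pochInf q q)⁻¹) := by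
  have ht : Filter.Tendsto Int.toNat Filter.atTop Filter.atTop :=
    Filter.tendsto_atTop_atTop.2 fun b => ⟨b, fun k hk => by omega⟩
  have h := (tendsto_invPoch_natCast hq0 hq1).comp ht
  refine h.congr' ?_
  filter_upwards [Filter.eventually_ge_atTop 0] with k hk
  simp [hk]

lemma exists_norm_invPoch_le {q : ℂ} (hq0 : q ≠ 0) (hq1 : ‖q‖ < 1) :
    ∃ C : ℝ, 0 < C ∧ ∀ k, ‖invPoch q k‖ ≤ C := by
  obtain ⟨C, hC⟩ := (Metric.isBounded_range_of_tendsto _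
    (tendsto_invPoch_natCast hq0 hq1)).exists_norm_le
  refine ⟨max C 1, by positivity, fun k => ?_⟩
  rcases lt_or_ge k 0 with hk | hk
  · simp [invPoch_of_neg hq0 hq1 hk]
  · lift k to ℕ using hk
    exact (hC _ ⟨k, rfl⟩).trans (le_max_left _ _)

/-- The factor `(-q; q)_k` satisfies its first-order recurrence for all integers `k`. -/
lemma poch_neg_succ {q : ℂ} (hq0 : q ≠ 0) (hq1 : ‖q‖ < 1) (k : ℤ) :
    poch (-q) q k = (1 + q ^ k) * poch (-q) q (k - 1) := by
  have h : pochInf (-q * q ^ k) q ≠ 0 := by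
    refine pochInf_ne_zero hq1 fun j h => ?_
    refine one_add_zpow_ne_zero hq1 (1 + k + j) ?_
    rw [zpow_add₀ hq0, zpow_add₀ hq0, zpow_natCast, zpow_one]
    linear_combination -h
  have h2 : pochInf (-q * q ^ (k - 1)) q = (1 + q ^ k) * pochInf (-q * q ^ k) q := by
    rw [show -q * q ^ (k - 1) = -q ^ k by rw [zpow_sub_one₀ hq0]; field_simp,
      pochInf_succ _ hq1, show -q ^ k * q = -q * q ^ k by ring]
    ring
  have h3 := one_add_zpow_ne_zero hq1 k
  rw [poch, poch, h2]
  field_simp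

lemma poch_neg_zero {q : ℂ} (hq0 : q ≠ 0) (hq1 : ‖q‖ < 1) : poch (-q) q 0 = 1 := by
  have h : pochInf (-q) q ≠ 0 := by
    refine pochInf_ne_zero hq1 fun j h => ?_
    refine one_add_zpow_ne_zero hq1 (1 + j) ?_
    rw [zpow_add₀ hq0, zpow_natCast, zpow_one]
    linear_combination -h
  simp [poch, div_self h]

lemma hasSum_of_eq {ι : Type*} {f g : ι → ℂ} {a b : ℂ} (h : HasSum f a) (hf : ∀ x, g x = f x)
    (hb : b = a) : HasSum g b := by
  rw [hb, show g = f from funext hf]; exact h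

lemma summable_of_eq_zero {f : ℤ → ℂ} (a b : ℤ) (h : ∀ k, k < a ∨ b < k → f k = 0) :
    Summable f :=
  summable_of_ne_finset_zero (s := Icc a b) fun k hk => h k (by simp at hk; omega)

/-- Splitting off a shifted part does not change the sum of a series over `ℤ`. -/
lemma hasSum_add_shift {f g : ℤ → ℂ} {S : ℂ} (hf : Summable f)
    (h : HasSum (fun k => f k + g k) S) : HasSum (fun k => f k + g (k - 1)) S := by
  have hg : HasSum g (S - ∑' k, f k) := by simpa using h.sub hf.hasSum
  have hg' : HasSum (fun k : ℤ => g (k - 1)) (S - ∑' k, f k) :=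
    (Equiv.subRight (1 : ℤ)).hasSum_iff.2 hg
  simpa using hf.hasSum.add hg'

lemma norm_sq_lt_one {q : ℂ} (hq1 : ‖q‖ < 1) : ‖q ^ 2‖ < 1 := by
  rw [norm_pow]; exact pow_lt_one₀ (norm_nonneg q) hq1 two_ne_zero

lemma sq_zpow (q : ℂ) (k : ℤ) : (q ^ 2) ^ k = q ^ (2 * k) := by
  rw [zpow_mul]; norm_cast

section Vandermonde

variable {q : ℂ} (hq0 : q ≠ 0) (hq1 : ‖q‖ < 1)
include hq0 hq1

lemma hasSum_vandermonde_nat (A : ℕ) (B : ℤ) :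
    HasSum (fun d : ℤ => q ^ ((A - d) * (B - d)) * invPoch q d * invPoch q (A - d) *
      invPoch q (B - d)) (invPoch q A * invPoch q B) := by
  induction A with
  | zero =>
    have := hasSum_single (f := fun d : ℤ => q ^ (((0 : ℕ) - d) * (B - d)) * invPoch q d *
      invPoch q ((0 : ℕ) - d) * invPoch q (B - d)) 0 (fun d hd => ?_)
    · simpa [invPoch_zero hq0 hq1] using this
    · rcases lt_or_gt_of_ne hd with h | h
      · simp [invPoch_of_neg hq0 hq1 h]
      · simp [invPoch_of_neg hq0 hq1 (k := -d) (by omega)]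
  | succ A ih =>
    have hA : (1 - q ^ ((A + 1 : ℕ) : ℤ)) ≠ 0 :=
      sub_ne_zero.2 (zpow_ne_one hq1 (by omega)).symm
    set T : ℤ → ℂ := fun d => q ^ ((A - d) * (B - d)) * invPoch q d * invPoch q (A - d) *
      invPoch q (B - d) with hT
    have hs : Summable fun d => T d * q ^ (B - d) := by
      refine summable_of_eq_zero 0 A fun k hk => ?_
      rcases hk with hk | hk
      · simp [hT, invPoch_of_neg hq0 hq1 hk]
      · simp [hT, invPoch_of_neg hq0 hq1 (k := A - k) (by omega)]
    have key := hasSum_add_shift (g := fun d => T d * (1 - q ^ (B - d))) hs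
      (hasSum_of_eq ih (fun d => by ring) rfl)
    have key2 := key.div_const (1 - q ^ ((A + 1 : ℕ) : ℤ))
    refine hasSum_of_eq key2 (fun d => ?_) ?_
    · rw [eq_div_iff hA]
      have e1 := one_sub_mul_invPoch hq0 hq1 (A + 1 - d)
      have e2 := one_sub_mul_invPoch hq0 hq1 d
      have e3 := one_sub_mul_invPoch hq0 hq1 (B - (d - 1))
      rw [show (A + 1 - d - 1 : ℤ) = A - d by ring] at e1
      rw [show (B - (d - 1) - 1 : ℤ) = B - d by ring] at e3
      have p1 : q ^ (((A + 1 : ℕ) - d) * (B - d)) = q ^ ((A - d) * (B - d)) * q ^ (B - d) := by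
        rw [← zpow_add₀ hq0]; push_cast; ring_nf
      have p2 : q ^ (((A : ℤ) - (d - 1)) * (B - (d - 1))) =
          q ^ ((A - d) * (B - d)) * q ^ (B - d) * q ^ (A + 1 - d) := by
        rw [← zpow_add₀ hq0, ← zpow_add₀ hq0]; ring_nf
      have p3 : q ^ ((A + 1 : ℕ) : ℤ) = q ^ (A + 1 - d) * q ^ d := by
        rw [← zpow_add₀ hq0]; push_cast; ring_nf
      simp only [hT]
      rw [p1, p2, p3, show (((A + 1 : ℕ) : ℤ) - d) = A + 1 - d by push_cast; ring,
        show ((A : ℤ) - (d - 1)) = A + 1 - d by ring, ← e1, ← e2,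
        show q ^ ((A - d) * (B - d)) * q ^ (B - d) * q ^ (A + 1 - d) * ((1 - q ^ d) * invPoch q d) *
          invPoch q (A + 1 - d) * invPoch q (B - (d - 1)) * (1 - q ^ (B - (d - 1))) =
          q ^ ((A - d) * (B - d)) * q ^ (B - d) * q ^ (A + 1 - d) * ((1 - q ^ d) * invPoch q d) *
          invPoch q (A + 1 - d) * ((1 - q ^ (B - (d - 1))) * invPoch q (B - (d - 1))) by ring, e3]
      ring
    · have e1 := one_sub_mul_invPoch hq0 hq1 ((A + 1 : ℕ) : ℤ)
      rw [show (((A + 1 : ℕ) : ℤ) - 1) = A by push_cast; ring] at e1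
      rw [eq_div_iff hA, ← e1]
      ring

/-- The `q`-Chu–Vandermonde sum with integer parameters. -/
lemma hasSum_vandermonde (A B : ℤ) :
    HasSum (fun d : ℤ => q ^ ((A - d) * (B - d)) * invPoch q d * invPoch q (A - d) *
      invPoch q (B - d)) (invPoch q A * invPoch q B) := by
  rcases lt_or_ge A 0 with hA | hA
  · rw [invPoch_of_neg hq0 hq1 hA, zero_mul]
    convert hasSum_zero using 2 with d
    rcases lt_or_ge d 0 with h | h
    · simp [invPoch_of_neg hq0 hq1 h]
    · simp [invPoch_of_neg hq0 hq1 (k := A - d) (by omega)]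
  · lift A to ℕ using hA
    exact hasSum_vandermonde_nat hq0 hq1 A B

/-- A companion of the `q`-Chu–Vandermonde sum, with the exponent lowered by `A - d`. -/
lemma hasSum_vandermonde_lowered (A B : ℤ) :
    HasSum (fun d : ℤ => q ^ ((A - d) * (B - d) - (A - d)) * invPoch q d * invPoch q (A - d) *
      invPoch q (B - d)) ((1 + q ^ (B - A) - q ^ B) * (invPoch q A * invPoch q B)) := by
  have h1 := hasSum_vandermonde hq0 hq1 A B
  have h2 := (hasSum_vandermonde hq0 hq1 (A - 1) B).mul_left (q ^ (B - A))
  refine hasSum_of_eq (h1.add h2) (fun d => ?_) ?_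
  · have e1 := one_sub_mul_invPoch hq0 hq1 (A - d)
    rw [show A - 1 - d = A - d - 1 by ring, ← e1]
    have p1 : q ^ ((A - d) * (B - d)) = q ^ ((A - d) * (B - d) - (A - d)) * q ^ (A - d) := by
      rw [← zpow_add₀ hq0]; ring_nf
    have p2 : q ^ ((A - d - 1) * (B - d)) =
        q ^ ((A - d) * (B - d) - (A - d)) * (q ^ (B - A))⁻¹ := by
      rw [← zpow_neg, ← zpow_add₀ hq0]; ring_nf
    have := zpow_ne_zero (B - A) hq0
    rw [p1, p2]
    field_simp
    ring
  · rw [← one_sub_mul_invPoch hq0 hq1 A, show q ^ B = q ^ (B - A) * q ^ A by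
      rw [← zpow_add₀ hq0]; ring_nf]
    ring

/-- The finite `q`-binomial theorem, in base `q ^ 2`. -/
lemma hasSum_qBinomial (z : ℂ) (N : ℕ) :
    HasSum (fun k : ℤ => (-1) ^ k * q ^ (k ^ 2 - k) * z ^ k * invPoch (q ^ 2) k *
      invPoch (q ^ 2) (N - k))
      ((∏ j ∈ range N, (1 - z * q ^ (2 * j))) * invPoch (q ^ 2) N) := by
  have hQ0 : q ^ 2 ≠ 0 := pow_ne_zero 2 hq0
  have hQ1 := norm_sq_lt_one hq1
  rcases eq_or_ne z 0 with rfl | hz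
  · have := hasSum_single (f := fun k : ℤ => (-1) ^ k * q ^ (k ^ 2 - k) * 0 ^ k *
      invPoch (q ^ 2) k * invPoch (q ^ 2) (N - k)) 0 (fun d hd => by simp [zero_zpow _ hd])
    simpa [invPoch_zero hQ0 hQ1] using this
  induction N with
  | zero =>
    have := hasSum_single (f := fun k : ℤ => (-1) ^ k * q ^ (k ^ 2 - k) * z ^ k *
      invPoch (q ^ 2) k * invPoch (q ^ 2) ((0 : ℕ) - k)) 0 (fun d hd => ?_)
    · simpa [invPoch_zero hQ0 hQ1] using this
    · rcases lt_or_gt_of_ne hd with h | h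
      · simp [invPoch_of_neg hQ0 hQ1 h]
      · simp [invPoch_of_neg hQ0 hQ1 (k := -d) (by omega)]
  | succ N ih =>
    have hA : (1 - (q ^ 2) ^ ((N + 1 : ℕ) : ℤ)) ≠ 0 :=
      sub_ne_zero.2 (zpow_ne_one hQ1 (by omega)).symm
    set T : ℤ → ℂ := fun k => (-1) ^ k * q ^ (k ^ 2 - k) * z ^ k * invPoch (q ^ 2) k *
      invPoch (q ^ 2) (N - k) with hT
    have hsum : HasSum (fun k => T k + (-z * q ^ (2 * N)) * T k)
        ((1 - z * q ^ (2 * N)) * ((∏ j ∈ range N, (1 - z * q ^ (2 * j))) * invPoch (q ^ 2) N)) := by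
      exact hasSum_of_eq (ih.mul_left (1 - z * q ^ (2 * N))) (fun k => by ring) rfl
    have key := (hasSum_add_shift ih.summable hsum).div_const (1 - (q ^ 2) ^ ((N + 1 : ℕ) : ℤ))
    refine hasSum_of_eq key (fun d => ?_) ?_
    · rw [eq_div_iff hA]
      have e1 := one_sub_mul_invPoch hQ0 hQ1 (N + 1 - d)
      have e2 := one_sub_mul_invPoch hQ0 hQ1 d
      rw [show (N + 1 - d - 1 : ℤ) = N - d by ring] at e1
      simp only [hT]
      rw [← e1, ← e2, show (((N + 1 : ℕ) : ℤ) - d) = N + 1 - d by push_cast; ring,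
        show ((N : ℤ) - (d - 1)) = N + 1 - d by ring]
      have p1 : (q ^ 2) ^ ((N + 1 : ℕ) : ℤ) = (q ^ 2) ^ (N + 1 - d) * (q ^ 2) ^ d := by
        rw [← zpow_add₀ hQ0]; push_cast; ring_nf
      have p2 : (-1 : ℂ) ^ (d - 1) = - (-1) ^ d := by
        rw [zpow_sub_one₀ (by norm_num)]; norm_num
      have p3 : z ^ d = z ^ (d - 1) * z := by
        rw [zpow_sub_one₀ hz]; field_simp
      have p4 : q ^ (2 * N) * q ^ ((d - 1) ^ 2 - (d - 1)) = (q ^ 2) ^ (N + 1 - d) *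
          q ^ (d ^ 2 - d) := by
        rw [sq_zpow, ← zpow_add₀ hq0, ← zpow_natCast, ← zpow_add₀ hq0]; push_cast; ring_nf
      rw [p1, p2, p3]
      linear_combination (-(-1) ^ d * z ^ (d - 1) * z * (1 - (q ^ 2) ^ d) * invPoch (q ^ 2) d *
        invPoch (q ^ 2) (N + 1 - d)) * p4
    · have e1 := one_sub_mul_invPoch hQ0 hQ1 ((N + 1 : ℕ) : ℤ)
      rw [show (((N + 1 : ℕ) : ℤ) - 1) = N by push_cast; ring] at e1
      rw [eq_div_iff hA, ← e1, prod_range_succ]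
      ring

end Vandermonde

section BaseChange

variable {q : ℂ} (hq0 : q ≠ 0) (hq1 : ‖q‖ < 1)
include hq0 hq1

lemma one_sub_mul_invPoch_sq (k : ℤ) :
    (1 - (q ^ k) ^ 2) * invPoch (q ^ 2) k = invPoch (q ^ 2) (k - 1) := by
  rw [← one_sub_mul_invPoch (pow_ne_zero 2 hq0) (norm_sq_lt_one hq1) k, sq_zpow, mul_comm 2 k,
    zpow_mul]
  norm_cast

/-- The summand of the base change formula from `q ^ 2` to `q`. -/
noncomputable def baseChangeTerm (q : ℂ) (A B d : ℤ) : ℂ :=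
  q ^ d * poch (-q) q (A + B - 2 * d) * invPoch (q ^ 2) d * invPoch (q ^ 2) (A - d) *
    invPoch (q ^ 2) (B - d)

lemma baseChangeTerm_eq_zero {A B d : ℤ} (h : d < 0 ∨ A < d ∨ B < d) :
    baseChangeTerm q A B d = 0 := by
  have hQ0 : q ^ 2 ≠ 0 := pow_ne_zero 2 hq0
  have hQ1 := norm_sq_lt_one hq1
  rcases h with h | h | h
  · simp [baseChangeTerm, invPoch_of_neg hQ0 hQ1 h]
  · simp [baseChangeTerm, invPoch_of_neg hQ0 hQ1 (k := A - d) (by omega)]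
  · simp [baseChangeTerm, invPoch_of_neg hQ0 hQ1 (k := B - d) (by omega)]

lemma baseChangeTerm_rec (A B d : ℤ) :
    (1 - q ^ (A + B)) * baseChangeTerm q A B d =
      baseChangeTerm q (A - 1) B d + baseChangeTerm q A (B - 1) d -
        baseChangeTerm q (A - 1) (B - 1) d +
      q ^ (A + B + 1) * (q ^ (-2 * (d - 1) - 2) * baseChangeTerm q (A - 1) (B - 1) (d - 1) -
        q ^ (-2 * d - 2) * baseChangeTerm q (A - 1) (B - 1) d) := by
  have e0 := one_sub_mul_invPoch_sq hq0 hq1 d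
  have eA := one_sub_mul_invPoch_sq hq0 hq1 (A - d)
  have eB := one_sub_mul_invPoch_sq hq0 hq1 (B - d)
  have f1 := poch_neg_succ hq0 hq1 (A + B - 2 * d)
  have f2 := poch_neg_succ hq0 hq1 (A + B - 2 * d - 1)
  simp only [baseChangeTerm]
  rw [show A - 1 + B - 2 * d = A + B - 2 * d - 1 by ring,
    show A + (B - 1) - 2 * d = A + B - 2 * d - 1 by ring,
    show A - 1 + (B - 1) - 2 * d = A + B - 2 * d - 1 - 1 by ring,
    show A - 1 + (B - 1) - 2 * (d - 1) = A + B - 2 * d by ring,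
    show A - 1 - d = A - d - 1 by ring, show B - 1 - d = B - d - 1 by ring,
    show A - 1 - (d - 1) = A - d by ring, show B - 1 - (d - 1) = B - d by ring,
    f1, f2, ← e0, ← eA, ← eB]
  have hd := zpow_ne_zero d hq0
  have r1 : q ^ (A + B) = q ^ (A - d) * q ^ (B - d) * (q ^ d) ^ 2 := by
    rw [← zpow_natCast, ← zpow_mul, ← zpow_add₀ hq0, ← zpow_add₀ hq0]; push_cast; ring_nf
  have r2 : q ^ (A + B + 1) = q ^ (A - d) * q ^ (B - d) * (q ^ d) ^ 2 * q := by
    rw [← r1, zpow_add_one₀ hq0]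
  have r3 : q ^ (A + B - 2 * d) = q ^ (A - d) * q ^ (B - d) := by
    rw [← zpow_add₀ hq0]; ring_nf
  have r4 : q ^ (A + B - 2 * d - 1) = q ^ (A - d) * q ^ (B - d) / q := by
    rw [zpow_sub_one₀ hq0, r3]; rfl
  have r5 : q ^ (-2 * (d - 1) - 2) = ((q ^ d) ^ 2)⁻¹ := by
    rw [← zpow_natCast, ← zpow_mul, ← zpow_neg]; push_cast; ring_nf
  have r6 : q ^ (-2 * d - 2) = ((q ^ d) ^ 2)⁻¹ / q ^ 2 := by
    rw [zpow_sub₀ hq0, ← zpow_natCast (q ^ d), ← zpow_mul, ← zpow_neg]; push_cast; ring_nf; norm_cast; ring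
  have r7 : q ^ (d - 1) = q ^ d / q := by rw [zpow_sub_one₀ hq0]; rfl
  rw [r1, r2, r3, r4, r5, r6, r7]
  generalize q ^ (A - d) = a
  generalize q ^ (B - d) = b
  generalize poch (-q) q (A + B - 2 * d - 1 - 1) = P
  generalize invPoch (q ^ 2) d = i0
  generalize invPoch (q ^ 2) (A - d) = i1
  generalize invPoch (q ^ 2) (B - d) = i2
  generalize q ^ d = D at hd ⊢
  field_simp
  ring

/-- Change of base from `q ^ 2` to `q` for the Bailey kernel. -/
lemma hasSum_baseChangeTerm (A B : ℤ) :
    HasSum (baseChangeTerm q A B) (invPoch q A * invPoch q B) := by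
  have hQ0 : q ^ 2 ≠ 0 := pow_ne_zero 2 hq0
  have hQ1 := norm_sq_lt_one hq1
  have neg : ∀ A B : ℤ, A < 0 ∨ B < 0 →
      HasSum (baseChangeTerm q A B) (invPoch q A * invPoch q B) := by
    intro A B h
    refine hasSum_of_eq hasSum_zero
      (fun d => baseChangeTerm_eq_zero hq0 hq1 (d := d) (by omega)) ?_
    rcases h with h | h <;> simp [invPoch_of_neg hq0 hq1 h]
  have key : ∀ n : ℕ, ∀ A B : ℤ, A + B < n →
      HasSum (baseChangeTerm q A B) (invPoch q A * invPoch q B) := by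
    intro n
    induction n with
    | zero => exact fun A B h => neg A B (by push_cast at h; omega)
    | succ n ih =>
      intro A B h
      push_cast at h
      by_cases hAB : A < 0 ∨ B < 0
      · exact neg A B hAB
      by_cases h0 : A + B = 0
      · obtain ⟨rfl, rfl⟩ : A = 0 ∧ B = 0 := by omega
        have := hasSum_single (f := baseChangeTerm q 0 0) 0
          (fun d hd => baseChangeTerm_eq_zero hq0 hq1 (by omega))
        simpa [baseChangeTerm, invPoch_zero hq0 hq1, invPoch_zero hQ0 hQ1,
          poch_neg_zero hq0 hq1] using this
      · have hne : 1 - q ^ (A + B) ≠ 0 := sub_ne_zero.2 (zpow_ne_one hq1 h0).symm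
        have hg : Summable fun d : ℤ =>
            q ^ (-2 * d - 2) * baseChangeTerm q (A - 1) (B - 1) d :=
          summable_of_eq_zero 0 A fun d hd => by
            rw [baseChangeTerm_eq_zero hq0 hq1 (by omega), mul_zero]
        have hg' : HasSum (fun d : ℤ =>
            q ^ (-2 * (d - 1) - 2) * baseChangeTerm q (A - 1) (B - 1) (d - 1))
            (∑' d : ℤ, q ^ (-2 * d - 2) * baseChangeTerm q (A - 1) (B - 1) d) :=
          (Equiv.subRight (1 : ℤ)).hasSum_iff.2 hg.hasSum
        have S := ((((ih (A - 1) B (by omega)).add (ih A (B - 1) (by omega))).sub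
          (ih (A - 1) (B - 1) (by omega))).add
          ((hg'.sub hg.hasSum).mul_left (q ^ (A + B + 1)))).mul_left (1 - q ^ (A + B))⁻¹
        refine hasSum_of_eq S (fun d => ?_) ?_
        · rw [← baseChangeTerm_rec hq0 hq1 A B d, inv_mul_cancel_left₀ hne]
        · rw [← one_sub_mul_invPoch hq0 hq1 A, ← one_sub_mul_invPoch hq0 hq1 B,
            eq_inv_mul_iff_mul_eq₀ hne, zpow_add₀ hq0]
          ring
  exact key (A + B + 1).toNat A B (by omega)

omit hq0 hq1 in
lemma poch_eq_inv_invPoch (k : ℤ) : poch q q k = (invPoch q k)⁻¹ := by simp [invPoch]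

/-- The Bailey pair, in base `q ^ 2`, whose `β`-side is a `q`-binomial coefficient. -/
lemma hasSum_qBinom (m : ℕ) (s : ℤ) :
    HasSum (fun j : ℤ => (-1) ^ j * q ^ (j ^ 2 - j) * invPoch (q ^ 2) (s - j) *
      invPoch (q ^ 2) (s + m + j))
      (q ^ (s ^ 2 - s) * (-1) ^ s * qBinom (m + s) (m + 2 * s) (q ^ 2)) := by
  have hQ0 : q ^ 2 ≠ 0 := pow_ne_zero 2 hq0
  have hQ1 := norm_sq_lt_one hq1
  rcases lt_or_ge (m + 2 * s) 0 with hN | hN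
  · refine hasSum_of_eq hasSum_zero (fun j => ?_) (by simp [qBinom, hN.not_ge])
    rcases lt_or_ge (s - j) 0 with h | h
    · simp [invPoch_of_neg hQ0 hQ1 h]
    · simp [invPoch_of_neg hQ0 hQ1 (k := s + m + j) (by omega)]
  obtain ⟨N, hN'⟩ : ∃ N : ℕ, (m : ℤ) + 2 * s = N := ⟨_, (Int.toNat_of_nonneg hN).symm⟩
  have h := (hasSum_qBinomial hq0 hq1 (q ^ (2 - 2 * s)) N).mul_left (q ^ (s ^ 2 - s) * (-1) ^ s)
  refine hasSum_of_eq ((Equiv.subLeft s).hasSum_iff.2 h) (fun j => ?_) ?_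
  · simp only [Function.comp, Equiv.subLeft_apply]
    rw [show (N : ℤ) - (s - j) = s + m + j by omega]
    have p1 : q ^ (j ^ 2 - j) =
        q ^ (s ^ 2 - s) * q ^ ((s - j) ^ 2 - (s - j)) * (q ^ (2 - 2 * s)) ^ (s - j) := by
      rw [← zpow_mul, ← zpow_add₀ hq0, ← zpow_add₀ hq0]; ring_nf
    have p2 : (-1 : ℂ) ^ j = (-1) ^ s * (-1) ^ (s - j) := by
      rw [← zpow_add₀ (by norm_num), show s + (s - j) = 2 * (s - j) + j by ring,
        zpow_add₀ (by norm_num), zpow_mul]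
      norm_num
    rw [p1, p2]
    ring
  · have hp : invPoch (q ^ 2) N ≠ 0 := invPoch_ne_zero hQ0 hQ1 (by omega)
    rw [hN']
    congr 1
    rcases lt_or_ge 0 s with hs | hs
    · rw [qBinom, if_neg (by omega), prod_eq_zero (i := (s - 1).toNat), zero_mul]
      · simp; omega
      · rw [← zpow_natCast, ← zpow_add₀ hq0]
        push_cast
        rw [Int.toNat_of_nonneg (by omega), show 2 - 2 * s + 2 * (s - 1) = 0 by ring]
        simp
    · have hsub : ∀ (u n : ℕ), (∏ j ∈ range n, (1 - q ^ (2 - 2 * (-(u : ℤ))) * q ^ (2 * j))) *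
          invPoch (q ^ 2) (n + u) = invPoch (q ^ 2) u := by
        intro u n
        induction n with
        | zero => simp
        | succ n ih =>
          rw [← ih, prod_range_succ, show (n : ℤ) + u = ((n + 1 : ℕ) : ℤ) + u - 1 by push_cast; ring,
            ← one_sub_mul_invPoch hQ0 hQ1 (((n + 1 : ℕ) : ℤ) + u), sq_zpow,
            show q ^ (2 - 2 * (-(u : ℤ))) * q ^ (2 * n) = q ^ (2 * (((n + 1 : ℕ) : ℤ) + u)) by
              rw [← zpow_natCast, ← zpow_add₀ hq0]; push_cast; ring_nf]
          ring
      obtain ⟨u, rfl⟩ : ∃ u : ℕ, s = -u := ⟨(-s).toNat, by omega⟩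
      have h1 := hsub u N
      have hne : invPoch (q ^ 2) (N + u) ≠ 0 := invPoch_ne_zero hQ0 hQ1 (by omega)
      have hu : invPoch (q ^ 2) u ≠ 0 := invPoch_ne_zero hQ0 hQ1 (by omega)
      rw [qBinom, if_pos (by omega), show (m : ℤ) + -u = N + u by omega,
        show (N : ℤ) + u - N = u by ring]
      simp only [poch_eq_inv_invPoch]
      rw [← h1] at hu ⊢
      obtain ⟨h2, -⟩ := mul_ne_zero_iff.1 hu
      field_simp
end BaseChange

/-- Interchange of summation for a doubly indexed family with finite support. -/
lemma hasSum_swap {F : ℤ → ℤ → ℂ} {g h : ℤ → ℂ} (a b : ℤ)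
    (hF : ∀ s j, ¬ ((a ≤ s ∧ s ≤ b) ∧ a ≤ j ∧ j ≤ b) → F s j = 0)
    (hg : ∀ s, HasSum (F s) (g s)) (hh : ∀ j, HasSum (fun s => F s j) (h j)) :
    HasSum g (∑' j, h j) := by
  have hs : Summable fun x : ℤ × ℤ => F x.1 x.2 :=
    summable_of_ne_finset_zero (s := Icc a b ×ˢ Icc a b) fun x hx => hF _ _ (by
      simpa only [mem_product, mem_Icc] using hx)
  have h1 := hs.hasSum.prod_fiberwise hg
  have h2 := ((Equiv.prodComm ℤ ℤ).hasSum_iff.2 hs.hasSum).prod_fiberwise hh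
  rwa [h2.tsum_eq]

lemma hasSum_prod_of_fiberwise {α β : Type*} {f : α × β → ℂ} {g : α → ℂ} {c : ℂ}
    (hs : Summable f) (h1 : ∀ a, HasSum (fun b => f (a, b)) (g a)) (h2 : HasSum g c) :
    HasSum f c :=
  (hs.hasSum.prod_fiberwise h1).unique h2 ▸ hs.hasSum

/-- The kernel of bilateral Bailey pairs relative to `q ^ m`. -/
noncomputable def kern (q : ℂ) (m : ℕ) (n j : ℤ) : ℂ := invPoch q (n - j) * invPoch q (n + m + j)

/-- The `α`-side of the iterated Bailey pair. -/
noncomputable def coeff (q : ℂ) (m p i : ℕ) (j : ℤ) : ℂ :=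
  (-1) ^ j * q ^ (j ^ 2 - j + p * (j ^ 2 + m * j) - i * j)

/-- The geometric sum `1 + x + ⋯ + x ^ (k - 1)`. -/
noncomputable def geo (x : ℂ) (k : ℕ) : ℂ := ∑ t ∈ range k, x ^ t

lemma geo_succ_succ (x : ℂ) (k : ℕ) : geo x (k + 2) = (1 + x) * geo x (k + 1) - x * geo x k := by
  simp only [geo, sum_range_succ]
  ring

/-- The terms of the `β`-side of the iterated Bailey pair. -/
noncomputable def pairTerm (q : ℂ) (m p i : ℕ) (L j : ℤ) : ℂ :=
  coeff q m p i j * (kern q m L j *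
    (geo (q ^ (m + 2 * j)) (i + 1) - q ^ (m + 2 * j) * q ^ (L - j) * geo (q ^ (m + 2 * j)) i))

/-- The innermost summand of the multisum. -/
noncomputable def baseTerm (q : ℂ) (m : ℕ) (L s : ℤ) : ℂ :=
  q ^ L * (q ^ (s ^ 2 - 2 * s) * poch (-q) q (m + 2 * s) * (-1) ^ s *
    qBinom (m + s) (m + 2 * s) (q ^ 2)) * invPoch (q ^ 2) (L - s)

section Steps

variable {q : ℂ} (hq0 : q ≠ 0) (hq1 : ‖q‖ < 1)
include hq0 hq1

lemma kern_eq_zero {m : ℕ} {n j : ℤ} (h : n < j ∨ n + m + j < 0) : kern q m n j = 0 := by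
  rcases h with h | h
  · simp [kern, invPoch_of_neg hq0 hq1 (k := n - j) (by omega)]
  · simp [kern, invPoch_of_neg hq0 hq1 h]

lemma hasSum_baseTerm (m : ℕ) (L : ℤ) :
    HasSum (baseTerm q m L) (∑' j, pairTerm q m 0 0 L j) := by
  have hQ0 : q ^ 2 ≠ 0 := pow_ne_zero 2 hq0
  have hQ1 := norm_sq_lt_one hq1
  refine hasSum_swap (F := fun s j => q ^ (L - s) * poch (-q) q (m + 2 * s) *
    invPoch (q ^ 2) (L - s) * ((-1) ^ j * q ^ (j ^ 2 - j) * invPoch (q ^ 2) (s - j) *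
      invPoch (q ^ 2) (s + m + j))) (- |L| - m) (|L| + m) (fun s j h => ?_) (fun s => ?_)
      (fun j => ?_)
  · have hL := abs_nonneg L
    have hL1 := le_abs_self L
    by_cases h1 : L - s < 0
    · simp [invPoch_of_neg hQ0 hQ1 h1]
    by_cases h2 : s - j < 0
    · simp [invPoch_of_neg hQ0 hQ1 h2]
    by_cases h3 : s + m + j < 0
    · simp [invPoch_of_neg hQ0 hQ1 h3]
    omega
  · refine hasSum_of_eq ((hasSum_qBinom hq0 hq1 m s).mul_left _) (fun _ => rfl) ?_
    have : q ^ L * q ^ (s ^ 2 - 2 * s) = q ^ (L - s) * q ^ (s ^ 2 - s) := by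
      rw [← zpow_add₀ hq0, ← zpow_add₀ hq0]; ring_nf
    rw [baseTerm]
    linear_combination (poch (-q) q (m + 2 * s) * (-1) ^ s *
      qBinom (m + s) (m + 2 * s) (q ^ 2) * invPoch (q ^ 2) (L - s)) * this
  · have h := ((Equiv.subLeft L).hasSum_iff.2 (hasSum_baseChangeTerm hq0 hq1 (L - j)
      (L + m + j))).mul_left ((-1) ^ j * q ^ (j ^ 2 - j))
    refine hasSum_of_eq h (fun s => ?_) ?_
    · simp only [Function.comp, Equiv.subLeft_apply, baseChangeTerm]
      rw [show L - j + (L + m + j) - 2 * (L - s) = m + 2 * s by ring,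
        show L - j - (L - s) = s - j by ring, show L + m + j - (L - s) = s + m + j by ring]
      ring
    · simp [pairTerm, coeff, kern, geo]

lemma hasSum_kern (m : ℕ) (L j : ℤ) :
    HasSum (fun s : ℤ => invPoch q (L - s) * q ^ (s ^ 2 + m * s) * kern q m s j)
      (q ^ (j ^ 2 + m * j) * kern q m L j) := by
  have h := ((Equiv.subLeft L).hasSum_iff.2 (hasSum_vandermonde hq0 hq1 (L - j)
      (L + m + j))).mul_left (q ^ (j ^ 2 + m * j))
  refine hasSum_of_eq h (fun s => ?_) (by rw [kern])
  simp only [Function.comp, Equiv.subLeft_apply, kern]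
  rw [show L - j - (L - s) = s - j by ring, show L + m + j - (L - s) = s + m + j by ring,
    show s ^ 2 + m * s = (j ^ 2 + m * j) + (s - j) * (s + m + j) by ring, zpow_add₀ hq0]
  ring

lemma hasSum_kern_lowered (m : ℕ) (L j : ℤ) :
    HasSum (fun s : ℤ => invPoch q (L - s) * q ^ (s ^ 2 + m * s - s) * kern q m s j)
      (q ^ (j ^ 2 + m * j - j) * (kern q m L j *
        (1 + q ^ (m + 2 * j) - q ^ (m + 2 * j) * q ^ (L - j)))) := by
  have h := ((Equiv.subLeft L).hasSum_iff.2 (hasSum_vandermonde_lowered hq0 hq1 (L - j)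
      (L + m + j))).mul_left (q ^ (j ^ 2 + m * j - j))
  refine hasSum_of_eq h (fun s => ?_) ?_
  · simp only [Function.comp, Equiv.subLeft_apply, kern]
    rw [show L - j - (L - s) = s - j by ring, show L + m + j - (L - s) = s + m + j by ring,
      show s ^ 2 + m * s - s = (j ^ 2 + m * j - j) + ((s - j) * (s + m + j) - (s - j)) by ring,
      zpow_add₀ hq0]
    ring
  · rw [kern, ← zpow_add₀ hq0, show L + m + j - (L - j) = m + 2 * j by ring,
      show m + 2 * j + (L - j) = L + m + j by ring]
    ring

lemma hasSum_pairTerm_zero (m p : ℕ) (L j : ℤ) :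
    HasSum (fun s : ℤ => invPoch q (L - s) * q ^ (s ^ 2 + m * s) * pairTerm q m p 0 s j)
      (pairTerm q m (p + 1) 0 L j) := by
  refine hasSum_of_eq ((hasSum_kern hq0 hq1 m L j).mul_left (coeff q m p 0 j)) (fun s => ?_) ?_
  · simp only [pairTerm, geo]; simp; ring
  · have : coeff q m (p + 1) 0 j = coeff q m p 0 j * q ^ (j ^ 2 + m * j) := by
      rw [coeff, coeff, mul_assoc, ← zpow_add₀ hq0]; push_cast; ring_nf
    simp only [pairTerm, geo, this]; simp; ring

lemma hasSum_pairTerm_succ (m p i : ℕ) (L j : ℤ) :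
    HasSum (fun s : ℤ => invPoch q (L - s) * q ^ (s ^ 2 + m * s - s) * pairTerm q m p i s j)
      (pairTerm q m (p + 1) (i + 1) L j) := by
  have h1 := (hasSum_kern_lowered hq0 hq1 m L j).mul_left
    (coeff q m p i j * geo (q ^ (m + 2 * j)) (i + 1))
  have h2 := (hasSum_kern hq0 hq1 m L j).mul_left
    (coeff q m p i j * (q ^ (m + 2 * j) * q ^ (-j) * geo (q ^ (m + 2 * j)) i))
  refine hasSum_of_eq (h1.sub h2) (fun s => ?_) ?_
  · have e : q ^ (s ^ 2 + m * s - s) * q ^ (s - j) = q ^ (s ^ 2 + m * s) * q ^ (-j) := by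
      rw [← zpow_add₀ hq0, ← zpow_add₀ hq0]; ring_nf
    rw [pairTerm]
    linear_combination (-(invPoch q (L - s)) * coeff q m p i j * kern q m s j *
      q ^ (m + 2 * j) * geo (q ^ (m + 2 * j)) i) * e
  · have e : coeff q m (p + 1) (i + 1) j = coeff q m p i j * q ^ (j ^ 2 + m * j - j) := by
      rw [coeff, coeff, mul_assoc, ← zpow_add₀ hq0]; push_cast; ring_nf
    have e2 : q ^ (-j) * q ^ (j ^ 2 + m * j) = q ^ (j ^ 2 + m * j - j) := by
      rw [← zpow_add₀ hq0]; ring_nf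
    rw [pairTerm, e, geo_succ_succ, ← e2]
    ring

lemma pairTerm_eq_zero {m p i : ℕ} {n j : ℤ} (h : n < j ∨ n + m + j < 0) :
    pairTerm q m p i n j = 0 := by
  simp [pairTerm, kern_eq_zero hq0 hq1 h]

lemma summable_pairTerm (m p i : ℕ) (L : ℤ) : Summable (pairTerm q m p i L) :=
  summable_of_eq_zero (-L - m) L fun j hj => pairTerm_eq_zero hq0 hq1 (by omega)

/-- The Gaussian weight of one level of the multisum; the lower levels have `i = 0`. -/
noncomputable def weight (q : ℂ) (m i : ℕ) (s : ℤ) : ℂ :=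
  q ^ (s ^ 2 + m * s - if i = 0 then 0 else s)

lemma hasSum_level (m p i : ℕ) (L : ℤ) :
    HasSum (fun s : ℤ => invPoch q (L - s) * weight q m i s * ∑' j, pairTerm q m p (i - 1) s j)
      (∑' j, pairTerm q m (p + 1) i L j) := by
  refine hasSum_swap (F := fun s j => invPoch q (L - s) * weight q m i s *
    pairTerm q m p (i - 1) s j) (- |L| - m) (|L| + m) (fun s j h => ?_) (fun s => ?_)
      (fun j => ?_)
  · have hL := abs_nonneg L
    have hL1 := le_abs_self L
    by_cases h1 : L - s < 0
    · simp [invPoch_of_neg hq0 hq1 h1]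
    · simp [pairTerm_eq_zero hq0 hq1 (m := m) (n := s) (j := j) (by omega)]
  · exact (summable_pairTerm hq0 hq1 m p (i - 1) s).hasSum.mul_left _
  · rcases i with _ | i
    · simpa [weight] using hasSum_pairTerm_zero hq0 hq1 m p L j
    · simpa [weight] using hasSum_pairTerm_succ hq0 hq1 m p i L j

end Steps

/-- The multisum summand over `(p + 1)`-tuples below the cutoff `L`. -/
noncomputable def cutTerm (q : ℂ) (m : ℕ) : (p i : ℕ) → ℤ → (Fin (p + 1) → ℤ) → ℂ
  | 0, _, L, s => baseTerm q m L (s 0)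
  | p + 1, i, L, s => invPoch q (L - s 0) *
      (weight q m i (s 0) * cutTerm q m p (i - 1) (s 0) (Fin.tail s))

lemma summable_gaussian {ρ : ℝ} (h0 : 0 < ρ) (h1 : ρ < 1) {a : ℤ} (ha : 1 ≤ a) (c : ℤ) :
    Summable fun s : ℤ => ρ ^ (a * s ^ 2 + c * s) := by
  have key : ∀ c : ℤ, Summable fun n : ℕ => ρ ^ (a * (n : ℤ) ^ 2 + c * n) := by
    intro c
    refine Summable.of_norm_bounded_eventually_nat (summable_geometric_of_lt_one h0.le h1) ?_
    filter_upwards [Filter.eventually_ge_atTop (|c| + 1).toNat] with n hn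
    rw [Real.norm_of_nonneg (by positivity), ← zpow_natCast ρ n]
    refine zpow_le_zpow_right_of_le_one₀ h0 h1.le ?_
    have h2 : |c| + 1 ≤ (n : ℤ) := by omega
    have h3 := neg_abs_le c
    nlinarith [sq_nonneg (n : ℤ)]
  refine Summable.of_nat_of_neg (key c) ?_
  refine (key (-c)).congr fun n => ?_
  congr 1
  ring

lemma summable_consEquiv {n : ℕ} {u : ℤ → ℝ} {v : (Fin n → ℤ) → ℝ} (hu : Summable u)
    (hv : Summable v) (hu0 : ∀ x, 0 ≤ u x) (hv0 : ∀ x, 0 ≤ v x) :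
    Summable fun s : Fin (n + 1) → ℤ => u (s 0) * v (Fin.tail s) := by
  have h := hu.mul_of_nonneg hv hu0 hv0
  exact (Fin.consEquiv fun _ : Fin (n + 1) => ℤ).symm.summable_iff.2 h

section Steps

variable {q : ℂ} (hq0 : q ≠ 0) (hq1 : ‖q‖ < 1)
include hq0 hq1

omit hq0 hq1 in
lemma norm_weight (m i : ℕ) (s : ℤ) :
    ‖weight q m i s‖ = ‖q‖ ^ (1 * s ^ 2 + (m - if i = 0 then 0 else 1) * s) := by
  rw [weight, norm_zpow]
  congr 1
  split_ifs <;> ring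

lemma summable_weight (m i : ℕ) :
    Summable fun s : ℤ => ‖weight q m i s‖ * (1 + ‖q‖ ^ s) := by
  have hn : 0 < ‖q‖ := norm_pos_iff.2 hq0
  have h1 := summable_gaussian hn hq1 le_rfl ((m : ℤ) - if i = 0 then 0 else 1)
  have h2 := summable_gaussian hn hq1 le_rfl ((m : ℤ) - (if i = 0 then 0 else 1) + 1)
  refine (h1.add h2).congr fun s => ?_
  rw [norm_weight, mul_add, mul_one, ← zpow_add₀ hn.ne']
  congr 2
  ring

lemma exists_cutTerm_bound (m p i : ℕ) : ∃ g : (Fin (p + 1) → ℤ) → ℝ, Summable g ∧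
    (∀ s, 0 ≤ g s) ∧ ∀ L s, ‖cutTerm q m p i L s‖ ≤ (1 + ‖q‖ ^ L) * g s := by
  have hn : 0 < ‖q‖ := norm_pos_iff.2 hq0
  induction p generalizing i with
  | zero =>
    obtain ⟨C, hC, hb⟩ := exists_norm_invPoch_le (pow_ne_zero 2 hq0) (norm_sq_lt_one hq1)
    let f : ℤ → ℂ := fun s => q ^ (s ^ 2 - 2 * s) * poch (-q) q (m + 2 * s) * (-1) ^ s *
      qBinom (m + s) (m + 2 * s) (q ^ 2)
    have hf : Summable fun s => ‖f s‖ * C := by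
      refine ((summable_of_eq_zero (-m) 0 fun s hs => ?_).norm).mul_right C
      have : qBinom (m + s) (m + 2 * s) (q ^ 2) = 0 := if_neg (by omega)
      simp [f, this]
    refine ⟨fun s => ‖f (s 0)‖ * C, (Equiv.funUnique (Fin 1) ℤ).summable_iff.2 hf,
      fun s => by positivity, fun L s => ?_⟩
    change ‖q ^ L * f (s 0) * invPoch (q ^ 2) (L - s 0)‖ ≤ _
    rw [norm_mul, norm_mul, norm_zpow, mul_assoc]
    have h1 := hb (L - s 0)
    have h2 : ‖q‖ ^ L ≤ 1 + ‖q‖ ^ L := by linarith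
    exact mul_le_mul h2 (mul_le_mul_of_nonneg_left h1 (norm_nonneg _)) (by positivity)
      (by positivity)
  | succ p ih =>
    obtain ⟨C, hC, hb⟩ := exists_norm_invPoch_le hq0 hq1
    obtain ⟨g, hg, hg0, hgb⟩ := ih (i - 1)
    have hs := summable_consEquiv ((summable_weight hq0 hq1 m i).mul_left C) hg
      (fun x => by positivity) hg0
    refine ⟨_, hs, fun s => mul_nonneg (by positivity) (hg0 _), fun L s => ?_⟩
    rw [cutTerm, norm_mul, norm_mul]
    have h1 := hb (L - s 0)
    have h2 := hgb (s 0) (Fin.tail s)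
    have h3 := hg0 (Fin.tail s)
    calc _ ≤ C * (‖weight q m i (s 0)‖ * ((1 + ‖q‖ ^ s 0) * g (Fin.tail s))) := by gcongr
      _ = 1 * (C * (‖weight q m i (s 0)‖ * (1 + ‖q‖ ^ s 0)) * g (Fin.tail s)) := by ring
      _ ≤ _ := by
        refine mul_le_mul_of_nonneg_right ?_ (by positivity)
        linarith [zpow_pos hn L]

lemma summable_cutTerm (m p i : ℕ) (L : ℤ) : Summable (cutTerm q m p i L) := by
  obtain ⟨g, hg, -, hb⟩ := exists_cutTerm_bound hq0 hq1 m p i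
  exact Summable.of_norm_bounded (hg.mul_left _) (hb L)

lemma hasSum_cutTerm (m : ℕ) {p i : ℕ} (hi : i ≤ p) (L : ℤ) :
    HasSum (cutTerm q m p i L) (∑' j, pairTerm q m p i L j) := by
  induction p generalizing i L with
  | zero =>
    obtain rfl : i = 0 := by omega
    exact (Equiv.funUnique (Fin 1) ℤ).hasSum_iff.2 (hasSum_baseTerm hq0 hq1 m L)
  | succ p ih =>
    rw [← (Fin.consEquiv fun _ : Fin (p + 2) => ℤ).hasSum_iff]
    refine hasSum_prod_of_fiberwise ((Equiv.summable_iff _).2 (summable_cutTerm hq0 hq1 m _ i L))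
      (fun a => ?_) (hasSum_level hq0 hq1 m p i L)
    refine hasSum_of_eq ((ih (i := i - 1) (by omega) a).mul_left _) (fun s => ?_) rfl
    simp [cutTerm, Fin.consEquiv, mul_assoc]

omit hq1 in
lemma norm_coeff_mul_pow (m p i t : ℕ) (j : ℤ) :
    ‖coeff q m p i j‖ * ‖q ^ (m + 2 * j)‖ ^ t =
      ‖q‖ ^ (m * t : ℤ) * ‖q‖ ^ ((1 + p) * j ^ 2 + (p * m - 1 - i + 2 * t) * j) := by
  have hn : ‖q‖ ≠ 0 := norm_ne_zero_iff.2 hq0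
  rw [coeff, norm_mul, norm_zpow, norm_zpow, norm_zpow, norm_neg, norm_one, one_zpow, one_mul,
    ← zpow_natCast, ← zpow_mul, ← zpow_add₀ hn, ← zpow_add₀ hn]
  congr 1
  ring

lemma summable_coeff_bound (m p i : ℕ) : Summable fun j =>
    ‖coeff q m p i j‖ * ∑ t ∈ range (i + 1), ‖q ^ (m + 2 * j)‖ ^ t := by
  simp only [mul_sum]
  refine summable_sum fun t _ => ?_
  simp only [norm_coeff_mul_pow hq0]
  exact (summable_gaussian (norm_pos_iff.2 hq0) hq1 (by omega) _).mul_left _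

omit hq0 hq1 in
lemma norm_geo_le (x : ℂ) (k : ℕ) : ‖geo x k‖ ≤ ∑ t ∈ range k, ‖x‖ ^ t :=
  (norm_sum_le _ _).trans_eq (by simp)

lemma exists_pairTerm_bound (m p i : ℕ) : ∃ C : ℝ, ∀ L j, ‖pairTerm q m p i L j‖ ≤
    C * (‖coeff q m p i j‖ * ∑ t ∈ range (i + 1), ‖q ^ (m + 2 * j)‖ ^ t) := by
  obtain ⟨C, hC, hb⟩ := exists_norm_invPoch_le hq0 hq1
  refine ⟨2 * C ^ 2, fun L j => ?_⟩
  set x := q ^ (m + 2 * j) with hx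
  rcases lt_or_ge L j with h | h
  · rw [pairTerm_eq_zero hq0 hq1 (Or.inl h), norm_zero]
    positivity
  have h1 : ‖q ^ (L - j)‖ ≤ 1 := by
    obtain ⟨n, hn⟩ := Int.eq_ofNat_of_zero_le (sub_nonneg.2 h)
    rw [hn, zpow_natCast, norm_pow]
    exact pow_le_one₀ (norm_nonneg q) hq1.le
  have h2 : ‖kern q m L j‖ ≤ C * C := by
    rw [kern, norm_mul]
    exact mul_le_mul (hb _) (hb _) (norm_nonneg _) hC.le
  have h3 : ‖x * q ^ (L - j) * geo x i‖ ≤ ∑ t ∈ range (i + 1), ‖x‖ ^ t := by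
    rw [norm_mul, norm_mul, sum_range_succ']
    calc ‖x‖ * ‖q ^ (L - j)‖ * ‖geo x i‖ ≤ ‖x‖ * 1 * ∑ t ∈ range i, ‖x‖ ^ t := by
          gcongr; exact norm_geo_le x i
      _ = ∑ t ∈ range i, ‖x‖ ^ (t + 1) := by
          rw [mul_one, mul_sum]; exact sum_congr rfl fun t _ => (pow_succ' _ _).symm
      _ ≤ _ := by simp
  rw [pairTerm, norm_mul, norm_mul]
  calc _ ≤ ‖coeff q m p i j‖ * (C * C * (∑ t ∈ range (i + 1), ‖x‖ ^ t +
        ∑ t ∈ range (i + 1), ‖x‖ ^ t)) := by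
        gcongr
        exact (norm_sub_le _ _).trans (add_le_add (norm_geo_le _ _) h3)
    _ = _ := by ring

omit hq0 in
lemma tendsto_zpow_atTop : Filter.Tendsto (fun L : ℤ => q ^ L) Filter.atTop (nhds 0) := by
  have ht : Filter.Tendsto Int.toNat Filter.atTop Filter.atTop :=
    Filter.tendsto_atTop_atTop.2 fun b => ⟨b, fun k hk => by omega⟩
  refine ((tendsto_pow_atTop_nhds_zero_of_norm_lt_one hq1).comp ht).congr' ?_
  filter_upwards [Filter.eventually_ge_atTop 0] with k hk
  lift k to ℕ using hk
  simp

lemma tendsto_tsum_pairTerm (m p i : ℕ) :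
    Filter.Tendsto (fun L : ℤ => ∑' j, pairTerm q m p i L j) Filter.atTop
      (nhds (∑' j, coeff q m p i j * ((pochInf q q)⁻¹ * (pochInf q q)⁻¹ *
        geo (q ^ (m + 2 * j)) (i + 1)))) := by
  obtain ⟨C, hC⟩ := exists_pairTerm_bound hq0 hq1 m p i
  refine tendsto_tsum_of_dominated_convergence
    ((summable_coeff_bound hq0 hq1 m p i).mul_left C) (fun j => ?_)
    (Filter.Eventually.of_forall fun L j => hC L j)
  have t1 : Filter.Tendsto (fun L : ℤ => L - j) Filter.atTop Filter.atTop :=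
    Filter.tendsto_atTop_add_const_right _ (-j) Filter.tendsto_id
  have t2 : Filter.Tendsto (fun L : ℤ => L + m + j) Filter.atTop Filter.atTop :=
    Filter.tendsto_atTop_add_const_right _ j
      (Filter.tendsto_atTop_add_const_right _ (m : ℤ) Filter.tendsto_id)
  have h1 := (tendsto_invPoch hq0 hq1).comp t1
  have h2 := (tendsto_invPoch hq0 hq1).comp t2
  have h3 := (tendsto_zpow_atTop hq1).comp t1
  have h4 := ((h1.mul h2).mul ((tendsto_const_nhds (x := geo (q ^ (m + 2 * j)) (i + 1))).sub
    ((h3.const_mul (q ^ (m + 2 * j))).mul_const (geo (q ^ (m + 2 * j)) i)))).const_mul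
      (coeff q m p i j)
  simpa [pairTerm, kern] using h4

/-- The multisum without cutoff, as a single bilateral series. -/
lemma hasSum_multisum (m : ℕ) {p i : ℕ} (hi : i ≤ p + 1) :
    HasSum (fun s : Fin (p + 2) → ℤ =>
      weight q m i (s 0) * cutTerm q m p (i - 1) (s 0) (Fin.tail s))
      ((pochInf q q)⁻¹ * ∑' j, coeff q m (p + 1) i j * geo (q ^ (m + 2 * j)) (i + 1)) := by
  set G : (Fin (p + 2) → ℤ) → ℂ := fun s =>
    weight q m i (s 0) * cutTerm q m p (i - 1) (s 0) (Fin.tail s) with hG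
  have hP := pochInf_self_ne_zero hq0 hq1
  obtain ⟨g, hg, hg0, hgb⟩ := exists_cutTerm_bound hq0 hq1 m p (i - 1)
  have hs := summable_consEquiv (summable_weight hq0 hq1 m i) hg (fun x => by positivity) hg0
  have hGb : ∀ s, ‖G s‖ ≤ ‖weight q m i (s 0)‖ * (1 + ‖q‖ ^ s 0) * g (Fin.tail s) := by
    intro s
    rw [hG, norm_mul, mul_assoc]
    exact mul_le_mul_of_nonneg_left (hgb _ _) (norm_nonneg _)
  have hGs : Summable G := Summable.of_norm_bounded hs hGb
  obtain ⟨C, hC, hb⟩ := exists_norm_invPoch_le hq0 hq1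
  have lim : Filter.Tendsto (fun L : ℤ => ∑' s, invPoch q (L - s 0) * G s) Filter.atTop
      (nhds (∑' s, (pochInf q q)⁻¹ * G s)) := by
    refine tendsto_tsum_of_dominated_convergence (hs.mul_left C) (fun s => ?_)
      (Filter.Eventually.of_forall fun L s => ?_)
    · have t1 : Filter.Tendsto (fun L : ℤ => L - s 0) Filter.atTop Filter.atTop :=
        Filter.tendsto_atTop_add_const_right _ (-s 0) Filter.tendsto_id
      exact ((tendsto_invPoch hq0 hq1).comp t1).mul_const _
    · rw [norm_mul]
      exact mul_le_mul (hb _) (hGb s) (norm_nonneg _) hC.le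
  have heq : ∀ L : ℤ, ∑' s, invPoch q (L - s 0) * G s = ∑' j, pairTerm q m (p + 1) i L j :=
    fun L => (hasSum_cutTerm hq0 hq1 m hi L).tsum_eq
  simp only [heq] at lim
  have h := tendsto_nhds_unique lim (tendsto_tsum_pairTerm hq0 hq1 m (p + 1) i)
  refine hasSum_of_eq hGs.hasSum (fun _ => rfl) ?_
  rw [tsum_mul_left, show (fun j => coeff q m (p + 1) i j * ((pochInf q q)⁻¹ * (pochInf q q)⁻¹ *
      geo (q ^ (m + 2 * j)) (i + 1))) = fun j => (pochInf q q)⁻¹ * (pochInf q q)⁻¹ *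
      (coeff q m (p + 1) i j * geo (q ^ (m + 2 * j)) (i + 1)) by funext j; ring, tsum_mul_left,
    mul_assoc] at h
  exact (mul_left_cancel₀ (inv_ne_zero hP) h).symm

omit hq1 in
lemma prod_range_two_mul {z : ℂ} (hz : z ≠ 0) (n : ℕ) :
    ∏ j ∈ range (2 * n), (1 - z * q ^ (-2 * n : ℤ) * q ^ (2 * j)) =
      (-1) ^ n * q ^ (-(n : ℤ) ^ 2 - n) * z ^ n *
        ((∏ j ∈ range n, (1 - z * (q ^ 2) ^ j)) * ∏ j ∈ range n, (1 - q ^ 2 / z * (q ^ 2) ^ j)) := by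
  have h1 : ∀ k : ℕ, ∏ j ∈ range k, (1 - z * q ^ (-2 * k : ℤ) * q ^ (2 * j)) =
      (-1) ^ k * q ^ (-(k : ℤ) ^ 2 - k) * z ^ k * ∏ j ∈ range k, (1 - q ^ 2 / z * (q ^ 2) ^ j) := by
    intro k
    induction k with
    | zero => simp
    | succ k ih =>
      rw [prod_range_succ', prod_range_succ]
      have e : ∀ j : ℕ, q ^ (-2 * ((k + 1 : ℕ) : ℤ)) * q ^ (2 * (j + 1)) =
          q ^ (-2 * k : ℤ) * q ^ (2 * j) := by
        intro j
        rw [← zpow_natCast, ← zpow_natCast, ← zpow_add₀ hq0, ← zpow_add₀ hq0]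
        push_cast; ring_nf
      simp only [mul_assoc z, e]
      simp only [← mul_assoc z, ih]
      have e2 : q ^ (-((k + 1 : ℕ) : ℤ) ^ 2 - ((k + 1 : ℕ) : ℤ)) =
          q ^ (-(k : ℤ) ^ 2 - k) * q ^ (-2 * ((k + 1 : ℕ) : ℤ)) := by
        rw [← zpow_add₀ hq0]; push_cast; ring_nf
      have e3 : q ^ (-2 * ((k + 1 : ℕ) : ℤ)) * (q ^ 2 * (q ^ 2) ^ k) = 1 := by
        rw [← pow_succ', ← pow_mul, ← zpow_natCast, ← zpow_add₀ hq0]; push_cast; ring_nf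
        simp
      rw [e2]
      generalize q ^ (-2 * ((k + 1 : ℕ) : ℤ)) = Y at e3 ⊢
      have e4 : (q ^ 2 / z * (q ^ 2) ^ k) * (z * Y) = 1 := by
        rw [← e3]; field_simp
      rw [mul_zero, pow_zero, mul_one, pow_succ (-1 : ℂ) k, pow_succ z k]
      linear_combination (-(-1) ^ k * q ^ (-(k : ℤ) ^ 2 - k) * z ^ k *
        ∏ j ∈ range k, (1 - q ^ 2 / z * (q ^ 2) ^ j)) * e4
  rw [two_mul, prod_range_add, h1]
  have e : ∀ j : ℕ, q ^ (-2 * n : ℤ) * q ^ (2 * (n + j)) = (q ^ 2) ^ j := by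
    intro j
    rw [← pow_mul, ← zpow_natCast, ← zpow_natCast, ← zpow_add₀ hq0]
    push_cast; ring_nf
  simp only [mul_assoc z, e]
  ring

/-- The finite form of the Jacobi triple product identity. -/
lemma hasSum_jacobi_finite {z : ℂ} (hz : z ≠ 0) (n : ℕ) :
    HasSum (fun j : ℤ => (-1) ^ j * q ^ (j ^ 2 - j) * z ^ j *
        (invPoch (q ^ 2) (n + j) * invPoch (q ^ 2) (n - j)))
      ((∏ j ∈ range n, (1 - z * (q ^ 2) ^ j)) * (∏ j ∈ range n, (1 - q ^ 2 / z * (q ^ 2) ^ j)) *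
        invPoch (q ^ 2) (2 * n)) := by
  have hm : (-1 : ℂ) ≠ 0 := by norm_num
  set c : ℂ := (-1) ^ n * q ^ (-(n : ℤ) ^ 2 - n) * z ^ n with hc
  have hc0 : c ≠ 0 := mul_ne_zero (mul_ne_zero (pow_ne_zero _ hm) (zpow_ne_zero _ hq0))
    (pow_ne_zero _ hz)
  have h := ((Equiv.addLeft (n : ℤ)).hasSum_iff.2
    (hasSum_qBinomial hq0 hq1 (z * q ^ (-2 * n : ℤ)) (2 * n))).mul_left c⁻¹
  refine hasSum_of_eq h (fun j => ?_) ?_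
  · simp only [Function.comp, Equiv.coe_addLeft]
    rw [eq_inv_mul_iff_mul_eq₀ hc0, hc, mul_zpow, ← zpow_mul, zpow_add₀ hm, zpow_add₀ hz,
      show (((2 * n : ℕ) : ℤ) - (n + j)) = n - j by push_cast; ring, zpow_natCast, zpow_natCast]
    have e : q ^ (-(n : ℤ) ^ 2 - n) * q ^ (j ^ 2 - j) =
        q ^ ((n + j) ^ 2 - (n + j)) * q ^ (-2 * n * (n + j)) := by
      rw [← zpow_add₀ hq0, ← zpow_add₀ hq0]; ring_nf
    linear_combination ((-1) ^ n * z ^ n * (-1) ^ j * z ^ j * invPoch (q ^ 2) (n + j) *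
      invPoch (q ^ 2) (n - j)) * e
  · rw [prod_range_two_mul hq0 hz, ← hc, mul_assoc c, inv_mul_cancel_left₀ hc0]
    push_cast
    rfl

/-- The Jacobi triple product identity. -/
lemma hasSum_jacobi {z : ℂ} (hz : z ≠ 0) :
    HasSum (fun j : ℤ => (-1) ^ j * q ^ (j ^ 2 - j) * z ^ j)
      (pochInf₃ (q ^ 2) z (q ^ 2 / z) (q ^ 2)) := by
  have hQ0 : q ^ 2 ≠ 0 := pow_ne_zero 2 hq0
  have hQ1 := norm_sq_lt_one hq1
  have hP := pochInf_self_ne_zero hQ0 hQ1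
  obtain ⟨C, hC, hb⟩ := exists_norm_invPoch_le hQ0 hQ1
  have hs : Summable fun j : ℤ => ‖(-1) ^ j * q ^ (j ^ 2 - j) * z ^ j‖ := by
    have hn : 0 < ‖q‖ := norm_pos_iff.2 hq0
    have hzn : 0 < ‖z‖ := norm_pos_iff.2 hz
    obtain ⟨N, hN⟩ := exists_pow_lt_of_lt_one (lt_min hzn (inv_pos.2 hzn)) hq1
    obtain ⟨hN1, hN2⟩ := lt_min_iff.1 hN
    have hN3 : ‖z‖ ≤ (‖q‖ ^ N)⁻¹ := by
      rw [le_inv_comm₀ hzn (by positivity)]; exact hN2.le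
    have hN4 : ‖z‖⁻¹ ≤ (‖q‖ ^ N)⁻¹ := inv_anti₀ (by positivity) hN1.le
    have hzj : ∀ j : ℤ, ‖z‖ ^ j ≤ ‖q‖ ^ (N * j) + ‖q‖ ^ (-N * j) := by
      intro j
      rw [neg_mul, zpow_neg, zpow_mul, zpow_natCast]
      obtain ⟨t, rfl | rfl⟩ := j.eq_nat_or_neg
      · simp only [zpow_natCast]
        have := pow_le_pow_left₀ hzn.le hN3 t
        rw [inv_pow] at this
        exact this.trans (le_add_of_nonneg_left (by positivity))
      · simp only [zpow_neg, zpow_natCast]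
        have := pow_le_pow_left₀ (by positivity) hN4 t
        rw [inv_pow, inv_pow] at this
        exact this.trans (le_add_of_nonneg_right (by positivity))
    have hg := (summable_gaussian hn hq1 le_rfl (-1 + N)).add
      (summable_gaussian hn hq1 le_rfl (-1 - N))
    refine Summable.of_nonneg_of_le (fun _ => norm_nonneg _) (fun j => ?_) hg
    rw [norm_mul, norm_mul, norm_zpow, norm_zpow, norm_zpow, norm_neg, norm_one, one_zpow, one_mul]
    refine (mul_le_mul_of_nonneg_left (hzj j) (by positivity)).trans_eq ?_
    rw [mul_add, ← zpow_add₀ hn.ne', ← zpow_add₀ hn.ne']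
    congr 2 <;> ring
  have t1 : ∀ j : ℤ, Filter.Tendsto (fun n : ℕ => (n : ℤ) + j) Filter.atTop Filter.atTop :=
    fun j => Filter.tendsto_atTop_add_const_right _ j tendsto_natCast_atTop_atTop
  have t2 : Filter.Tendsto (fun n : ℕ => 2 * (n : ℤ)) Filter.atTop Filter.atTop :=
    tendsto_natCast_atTop_atTop.const_mul_atTop' (by norm_num)
  have lim : Filter.Tendsto (fun n : ℕ => ∑' j : ℤ, (-1) ^ j * q ^ (j ^ 2 - j) * z ^ j *
      (invPoch (q ^ 2) (n + j) * invPoch (q ^ 2) (n - j))) Filter.atTop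
      (nhds (∑' j : ℤ, (-1) ^ j * q ^ (j ^ 2 - j) * z ^ j *
        ((pochInf (q ^ 2) (q ^ 2))⁻¹ * (pochInf (q ^ 2) (q ^ 2))⁻¹))) := by
    refine tendsto_tsum_of_dominated_convergence (hs.mul_right (C * C)) (fun j => ?_)
      (Filter.Eventually.of_forall fun n j => ?_)
    · exact (((tendsto_invPoch hQ0 hQ1).comp (t1 j)).mul
        ((tendsto_invPoch hQ0 hQ1).comp (t1 (-j)))).const_mul _
    · rw [norm_mul, norm_mul (invPoch _ _)]
      exact mul_le_mul_of_nonneg_left (mul_le_mul (hb _) (hb _) (norm_nonneg _) hC.le)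
        (norm_nonneg _)
  have lim2 := ((multipliable_poch z hQ1).hasProd.tendsto_prod_nat.mul
    (multipliable_poch (q ^ 2 / z) hQ1).hasProd.tendsto_prod_nat).mul
    ((tendsto_invPoch hQ0 hQ1).comp t2)
  have h := tendsto_nhds_unique lim
    (lim2.congr fun n => (hasSum_jacobi_finite hq0 hq1 hz n).tsum_eq.symm)
  refine hasSum_of_eq hs.of_norm.hasSum (fun _ => rfl) ?_
  rw [tsum_mul_right] at h
  change _ = pochInf z (q ^ 2) * pochInf (q ^ 2 / z) (q ^ 2) * (pochInf (q ^ 2) (q ^ 2))⁻¹ at h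
  rw [pochInf₃]
  field_simp at h
  rw [h]

end Steps

@[to_additive]
lemma prod_Icc_head_mul {M : Type*} [CommMonoid M] (f : ℕ → M) (n : ℕ) :
    ∏ j ∈ Icc 1 (n + 1), f j = f 1 * ∏ j ∈ Icc 1 n, f (j + 1) := by
  induction n with
  | zero => simp
  | succ n ih =>
    rw [prod_Icc_succ_top (by omega), ih, prod_Icc_succ_top (by omega), mul_assoc]

lemma coord_tail {n : ℕ} (s : Fin (n + 1) → ℤ) {j : ℕ} (hj : 1 ≤ j) :
    coord s (j + 1) = coord (Fin.tail s) j := by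
  unfold coord
  by_cases h : j ≤ n
  · rw [dif_pos (by omega), dif_pos (by omega), Fin.tail]
    congr 1
    ext
    simp
    omega
  · rw [dif_neg (by omega), dif_neg (by omega)]

lemma coord_one {n : ℕ} (s : Fin (n + 1) → ℤ) : coord s 1 = s 0 := by
  simp [coord]

lemma sum_coord_tail {n : ℕ} (s : Fin (n + 1) → ℤ) (f : ℤ → ℤ) (k : ℕ) :
    ∑ j ∈ Icc 1 (k + 1), f (coord s j) = f (s 0) + ∑ j ∈ Icc 1 k, f (coord (Fin.tail s) j) := by
  rw [sum_Icc_head_add, coord_one]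
  congr 1
  refine sum_congr rfl fun j hj => ?_
  rw [coord_tail s (mem_Icc.1 hj).1]

lemma expo_succ (m p i : ℕ) (s : Fin (p + 3) → ℤ) :
    expo m (p + 3) i s = (s 0 ^ 2 + m * s 0 - if i = 0 then 0 else s 0) +
      expo m (p + 2) (i - 1) (Fin.tail s) := by
  unfold expo
  have h1 := sum_coord_tail s (fun x => x ^ 2) (p + 2)
  have h2 := sum_coord_tail s (fun x => x) (p + 1)
  have h3 : ∑ j ∈ Icc 1 i, coord s j =
      (if i = 0 then 0 else s 0) + ∑ j ∈ Icc 1 (i - 1), coord (Fin.tail s) j := by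
    rcases i with _ | i
    · simp
    · simpa using sum_coord_tail s (fun x => x) i
  simp only [show p + 3 - 1 = p + 1 + 1 from rfl, show p + 2 - 1 = p + 1 from rfl]
  rw [h1, h2, h3, coord_tail s (by omega : 1 ≤ p + 1),
    show coord s (p + 3) = _ from coord_tail s (by omega : 1 ≤ p + 2)]
  ring

section Final

variable {q : ℂ} (hq0 : q ≠ 0)
include hq0

lemma summand_succ (m p i : ℕ) (s : Fin (p + 3) → ℤ) :
    summand m (p + 3) i q s = weight q m i (s 0) *
      (invPoch q (s 0 - Fin.tail s 0) * summand m (p + 2) (i - 1) q (Fin.tail s)) := by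
  unfold summand
  rw [expo_succ, zpow_add₀ hq0, ← weight]
  simp only [show p + 3 - 2 = p + 1 from rfl, show p + 2 - 2 = p from rfl,
    show p + 3 - 1 = p + 1 + 1 from rfl, show p + 2 - 1 = p + 1 from rfl]
  have h : ∏ j ∈ Icc 1 (p + 1), poch q q (coord s j - coord s (j + 1)) =
      poch q q (s 0 - Fin.tail s 0) * ∏ j ∈ Icc 1 p,
        poch q q (coord (Fin.tail s) j - coord (Fin.tail s) (j + 1)) := by
    rw [prod_Icc_head_mul, coord_one, coord_tail s le_rfl, coord_one]
    congr 1
    refine prod_congr rfl fun j hj => ?_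
    rw [coord_tail s (mem_Icc.1 hj).1, coord_tail s (by omega)]
  rw [h, coord_tail s (by omega : 1 ≤ p + 1),
    show coord s (p + 3) = _ from coord_tail s (by omega : 1 ≤ p + 2)]
  simp only [invPoch, div_eq_mul_inv, mul_inv]
  ring

lemma summand_eq (m : ℕ) {p i : ℕ} (hi : i ≤ p + 1) (s : Fin (p + 2) → ℤ) :
    summand m (p + 2) i q s =
      weight q m i (s 0) * cutTerm q m p (i - 1) (s 0) (Fin.tail s) := by
  induction p generalizing i with
  | zero =>
    have hs2 : coord s 2 = Fin.tail s 0 := by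
      rw [coord_tail s le_rfl, coord_one]
    have he : q ^ expo m 2 i s = weight q m i (s 0) * (q ^ s 0 *
        q ^ (Fin.tail s 0 ^ 2 - 2 * Fin.tail s 0)) := by
      rw [weight, ← zpow_add₀ hq0, ← zpow_add₀ hq0, expo]
      have h3 : ∑ j ∈ Icc 1 i, coord s j = if i = 0 then 0 else s 0 := by
        obtain rfl | rfl : i = 0 ∨ i = 1 := by omega
        · simp
        · simp [coord_one]
      rw [h3, show Icc 1 2 = {1, 2} from rfl, sum_pair (by norm_num)]
      simp only [show 2 - 1 = 1 from rfl, Icc_self, sum_singleton, coord_one, hs2]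
      congr 1
      ring
    simp only [summand, cutTerm, baseTerm, zero_add, he, hs2, coord_one, invPoch,
      show 2 - 1 = 1 from rfl, show 2 - 2 = 0 from rfl]
    simp only [div_eq_mul_inv, Icc_eq_empty (by norm_num : ¬ (1 : ℕ) ≤ 0), prod_empty, one_mul]
    ring
  | succ p ih =>
    rw [summand_succ hq0, ih (by omega), cutTerm]

lemma support_summand_subset (hq1 : ‖q‖ < 1) (m i : ℕ) {r : ℕ} (hr : 2 ≤ r) :
    Function.support (summand m r i q) ⊆ chains m r := by
  intro s hs
  rw [Function.mem_support, summand, div_eq_mul_inv, mul_inv] at hs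
  simp only [mul_ne_zero_iff] at hs
  obtain ⟨⟨⟨-, h1, h2⟩, -⟩, h3⟩ := hs
  refine ⟨fun j hj1 hj2 => ?_, ?_⟩
  · by_contra! hlt
    rcases (by omega : j ≤ r - 2 ∨ j = r - 1) with h | rfl
    · refine h1 (inv_eq_zero.2 (prod_eq_zero (mem_Icc.2 ⟨hj1, h⟩) ?_))
      exact inv_eq_zero.1 (invPoch_of_neg hq0 hq1 (by omega))
    · rw [show r - 1 + 1 = r by omega] at hlt
      exact h2 (invPoch_of_neg (pow_ne_zero 2 hq0) (norm_sq_lt_one hq1) (by omega))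
  · by_contra! hlt
    exact h3 (if_neg (by omega))

lemma tsum_coeff (hq1 : ‖q‖ < 1) (m p i : ℕ) :
    ∑' j, coeff q m (p + 1) i j * geo (q ^ (m + 2 * j)) (i + 1) =
      ∑ k ∈ range (i + 1), q ^ (m * k) * pochInf₃ (q ^ (2 * (p + 2)))
        (q ^ (((m : ℤ) + 1) * ((p : ℤ) + 1) - i + 2 * k))
        (q ^ ((1 - (m : ℤ)) * ((p : ℤ) + 2) + m + i - 2 * k + 1)) (q ^ (2 * (p + 2))) := by
  have hQ1 : ‖q ^ (p + 2)‖ < 1 := by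
    rw [norm_pow]; exact pow_lt_one₀ (norm_nonneg q) hq1 (by omega)
  have h := hasSum_sum (s := range (i + 1)) fun k _ =>
    (hasSum_jacobi (pow_ne_zero (p + 2) hq0) hQ1
      (zpow_ne_zero (((m : ℤ) + 1) * ((p : ℤ) + 1) - i + 2 * k) hq0)).mul_left (q ^ (m * k))
  refine (hasSum_of_eq h (fun j => ?_) ?_).tsum_eq
  · rw [geo, mul_sum]
    refine sum_congr rfl fun k _ => ?_
    have e : q ^ (j ^ 2 - j + ((p + 1 : ℕ) : ℤ) * (j ^ 2 + m * j) - i * j) *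
        (q ^ (m + 2 * j)) ^ k = q ^ (m * k) * ((q ^ (p + 2)) ^ (j ^ 2 - j) *
        (q ^ (((m : ℤ) + 1) * ((p : ℤ) + 1) - i + 2 * k)) ^ j) := by
      rw [← zpow_natCast, ← zpow_natCast, ← zpow_natCast, ← zpow_mul, ← zpow_mul, ← zpow_mul,
        ← zpow_add₀ hq0, ← zpow_add₀ hq0, ← zpow_add₀ hq0]
      push_cast
      ring_nf
    rw [coeff]
    linear_combination (-1) ^ j * e
  · refine sum_congr rfl fun k _ => ?_
    have e : (q ^ (p + 2)) ^ 2 / q ^ (((m : ℤ) + 1) * ((p : ℤ) + 1) - i + 2 * k) =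
        q ^ ((1 - (m : ℤ)) * ((p : ℤ) + 2) + m + i - 2 * k + 1) := by
      rw [← pow_mul, ← zpow_natCast, ← zpow_sub₀ hq0]
      push_cast
      ring_nf
    rw [e, ← pow_mul, mul_comm (p + 2) 2]

end Final
end QSeries

theorem theorem1p16 (m r i : ℕ) (hr : 2 ≤ r) (hi : i ≤ r - 1) (q : ℂ) (hq0 : q ≠ 0)
    (hq1 : ‖q‖ < 1) :
    HasSum (fun s : QSeries.chains m r => QSeries.summand m r i q (s : Fin r → ℤ))
      (∑ k ∈ Finset.range (i + 1), q ^ (m * k) *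
        (QSeries.pochInf₃ (q ^ (2 * r))
            (q ^ (((m : ℤ) + 1) * ((r : ℤ) - 1) - (i : ℤ) + 2 * (k : ℤ)))
            (q ^ ((1 - (m : ℤ)) * (r : ℤ) + (m : ℤ) + (i : ℤ) - 2 * (k : ℤ) + 1))
            (q ^ (2 * r)) /
          QSeries.pochInf q q)) := by
  obtain ⟨p, rfl⟩ : ∃ p, r = p + 2 := ⟨r - 2, by omega⟩
  refine (hasSum_subtype_iff_of_support_subset
    (QSeries.support_summand_subset hq0 hq1 m i hr)).2 ?_
  have hi' : i ≤ p + 1 := by omega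
  refine QSeries.hasSum_of_eq (QSeries.hasSum_multisum hq0 hq1 m hi')
    (QSeries.summand_eq hq0 m hi') ?_
  rw [QSeries.tsum_coeff hq0 hq1, Finset.mul_sum]
  refine Finset.sum_congr rfl fun k _ => ?_
  push_cast
  rw [show (p : ℤ) + 2 - 1 = p + 1 by ring]
  ring
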